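/- Let $\Delta$ be a simplicial complex on an ordered ground set $\{v_1,\dots,v_n\}$, that is, a collection of subsets (faces, including the empty one) closed under taking subsets. Suppose $\Delta$ is shifted: whenever $\sigma\in\Delta$, $v_i\in\sigma$ and $j<i$, also $(\sigma\setminus\{v_i\})\cup\{v_j\}\in\Delta$. Suppose that the minimal cardinality of a facet (inclusion-maximal face) of $\Delta$ is $k$, and let $1\le t\le r$ be integers with $k\ge (t+1)(r-t+1)$. For a face $\sigma$ let $\mathrm{lk}_\Delta\sigma=\{\tau:\tau\cup\sigma\in\Delta,\ \tau\cap\sigma=\emptyset\}$, let $f_s(\Gamma)$ be the number of faces of cardinality $s$ of a complex $\Gamma$, and call a family of sets $t$-intersecting if any two of its members meet in at least $t$ elements. Then $\Delta$ is $(t,r)$-EKR: every $t$-intersecting family $\mathcal A$ of faces of $\Delta$ of cardinality $r$ satisfies $$|\mathcal A|\le \max\{f_{r-t}(\mathrm{lk}_\Delta\sigma):\sigma\in\Delta,\ |\sigma|=t\}.$$ More precisely, $\{v_1,\dots,v_t\}$ is a face of $\Delta$ with $t$ elements, and every such family satisfies $$|\mathcal A|\le f_{r-t}(\mathrm{lk}_\Delta\{v_1,\dots,v_t\}).$$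 -/

import Mathlib

/-- A simplicial complex on the ordered ground set `v_1 < ⋯ < v_n` (with `v_i` the element
`i - 1` of `Fin n`): a collection of subsets closed under taking subsets. As usual in
combinatorics, the empty set is a face of every complex that has a face at all. -/
structure FinComplex (n : ℕ) where
  /-- the faces, including the empty one -/
  faces : Finset (Finset (Fin n))
  isLowerSet_faces : IsLowerSet (faces : Set (Finset (Fin n)))

namespace FinComplex

variable {n : ℕ}

/-- A facet is a face that is maximal with respect to inclusion. -/
def IsFacet (Δ : FinComplex n) (F : Finset (Fin n)) : Prop :=
  Maximal (fun G => G ∈ Δ.faces) F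

/-- `k` is the minimal cardinality of a facet. -/
def IsMinFacetCard (Δ : FinComplex n) (k : ℕ) : Prop :=
  IsLeast {m : ℕ | ∃ F : Finset (Fin n), Δ.IsFacet F ∧ F.card = m} k

/-- The `r`-faces: the faces of cardinality `r`. -/
def rFaces (Δ : FinComplex n) (r : ℕ) : Finset (Finset (Fin n)) :=
  Δ.faces.filter (fun F => F.card = r)

/-- `f_r(Δ)`, the number of `r`-faces. -/
def f (Δ : FinComplex n) (r : ℕ) : ℕ := (Δ.rFaces r).card

/-- The link of `σ`: all `τ` disjoint from `σ` with `τ ∪ σ` a face. -/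
def link (Δ : FinComplex n) (σ : Finset (Fin n)) : FinComplex n where
  faces := Finset.univ.filter (fun τ => τ ∪ σ ∈ Δ.faces ∧ τ ∩ σ = ∅)
  isLowerSet_faces := by
    intro a b hba ha
    simp only [Finset.coe_filter, Finset.mem_univ, true_and, Set.mem_ofPred_eq] at ha ⊢
    refine ⟨Δ.isLowerSet_faces (Finset.union_subset_union_left hba) ha.1, ?_⟩
    exact Finset.subset_empty.mp (ha.2 ▸ Finset.inter_subset_inter_right hba)

/-- Shiftedness: in a face, a vertex may be replaced by any earlier one. -/
def IsShifted (Δ : FinComplex n) : Prop :=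
  ∀ σ ∈ Δ.faces, ∀ i ∈ σ, ∀ j : Fin n, j < i → insert j (σ.erase i) ∈ Δ.faces

/-- `𝒜` is a `t`-intersecting `r`-family of faces of `Δ`. -/
def IsIntersectingFamily (Δ : FinComplex n) (t r : ℕ) (𝒜 : Finset (Finset (Fin n))) : Prop :=
  𝒜 ⊆ Δ.rFaces r ∧ ∀ A ∈ 𝒜, ∀ B ∈ 𝒜, t ≤ (A ∩ B).card

/-- `Δ` is `(t,r)`-EKR: every `t`-intersecting `r`-family of faces has at most
`max f_{r-t}(lk σ)` members, the maximum being over the `t`-faces `σ` of `Δ`. -/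
def IsEKR (Δ : FinComplex n) (t r : ℕ) : Prop :=
  ∀ 𝒜 : Finset (Finset (Fin n)), Δ.IsIntersectingFamily t r 𝒜 →
    𝒜.card ≤ (Δ.rFaces t).sup (fun σ => (Δ.link σ).f (r - t))

end FinComplex

/-- The set `{v_1, …, v_t}` of the first `t` vertices (for `t ≤ n`). -/
def firstVertices (n t : ℕ) : Finset (Fin n) :=
  Finset.univ.filter (fun i => (i : ℕ) < t)

/-!
A shifted complex is handled by induction on the number of vertices. A `t`-intersecting family of
faces may be compressed with respect to the last vertex without leaving the complex. The members
avoiding the last vertex are faces of its deletion; the others, with that vertex removed, are faces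
of its link and are still `t`-intersecting, since two of them with too small an intersection would
cover all vertices (`TIntersecting.card_add_card`). Deletion and link are again shifted, with
facets of at least `k` and `k - 1` elements, so the two bounds add up to the claimed one. The
exception is the full simplex, whose deletion has a smaller facet. There the claim is the theorem of
Frankl and Wilson (`TIntersecting.card_le_choose`), for `n ≥ (t + 1) * (r - t + 1)`.

The theorem of Frankl and Wilson is proved by a variant of the generating set method of Ahlswede and
Khachatrian. For a family on the first `m` points, weigh each member by its number of extensions
to `k`-sets by means of the other `n - m` points. It suffices that the largest weight of a
`t`-intersecting family does not grow as `m` goes up from `t`, where the only candidate is the single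
set of all `t` points. Take a family on `{0, …, p}` of the largest weight, compressed at `p`. If `p`
can be removed from every member containing it without leaving the family, then the weight is at
most that of the restriction to `{0, …, p - 1}`. Consider then the members that contain `p` and
leave the family without it. Two of them that no longer share `t` elements after `p` is removed
have sizes `a` and `b` with `a + b = p + 1 + t`. If `a ≠ b`, the members of one size may be dropped
in return for removing `p` from those of the other; log-concavity of binomial coefficients shows that
one of the two choices does not lower the weight (`exchange_of_size_ne`). If `a = b`, there is a point
`x < p` avoided by at least an average share of these members; `p` is removed from those avoiding
`x` and the others are dropped (`exchange_of_size_eq`). At the extreme value of `n` such an exchange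
may leave the weight unchanged, so a secondary weight favouring small sets breaks ties
(`steepWeight`).
-/

/-! ### Intersecting families and compression at the last element -/

/-- A family of sets is `t`-intersecting if any two members, possibly equal, share at least `t`
elements. -/
def TIntersecting (t : ℕ) (U : Finset (Finset ℕ)) : Prop :=
  ∀ A ∈ U, ∀ B ∈ U, t ≤ (A ∩ B).card

/-- The image of a single set under the compression `p → j` of the family `U`: `p` is replaced by
`j`, unless this is impossible or gives a set that is already in `U`. -/
def compressSet (j p : ℕ) (U : Finset (Finset ℕ)) (E : Finset ℕ) : Finset ℕ :=
  if p ∈ E ∧ j ∉ E ∧ insert j (E.erase p) ∉ U then insert j (E.erase p) else E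

/-- A family is compressed at `p` if it is stable under replacing `p` by any smaller element. -/
def CompressedAt (p : ℕ) (U : Finset (Finset ℕ)) : Prop :=
  ∀ E ∈ U, p ∈ E → ∀ j < p, j ∉ E → insert j (E.erase p) ∈ U

lemma card_insert_erase_of_mem_of_notMem {j p : ℕ} {E : Finset ℕ} (hp : p ∈ E) (hj : j ∉ E) :
    (insert j (E.erase p)).card = E.card := by
  rw [Finset.card_insert_of_notMem (fun h => hj (Finset.mem_of_mem_erase h)),
    Finset.card_erase_add_one hp]

lemma card_compressSet (j p : ℕ) (U : Finset (Finset ℕ)) (E : Finset ℕ) :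
    (compressSet j p U E).card = E.card := by
  unfold compressSet
  split_ifs with h
  · exact card_insert_erase_of_mem_of_notMem h.1 h.2.1
  · rfl

lemma eq_of_insert_erase_eq {j p : ℕ} {A B : Finset ℕ} (hA : p ∈ A) (hB : p ∈ B)
    (hjA : j ∉ A) (hjB : j ∉ B) (h : insert j (A.erase p) = insert j (B.erase p)) : A = B := by
  have h1 : (insert j (A.erase p)).erase j = (insert j (B.erase p)).erase j := by rw [h]
  rw [Finset.erase_insert (fun h => hjA (Finset.mem_of_mem_erase h)),
    Finset.erase_insert (fun h => hjB (Finset.mem_of_mem_erase h))] at h1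
  rw [← Finset.insert_erase hA, h1, Finset.insert_erase hB]

lemma compressSet_injOn (j p : ℕ) (U : Finset (Finset ℕ)) :
    Set.InjOn (compressSet j p U) U := by
  intro A hA B hB h
  unfold compressSet at h
  split_ifs at h with h1 h2 h2
  · exact eq_of_insert_erase_eq h1.1 h2.1 h1.2.1 h2.2.1 h
  · exact absurd (h ▸ hB) h1.2.2
  · exact absurd (h ▸ hA) h2.2.2
  · exact h

lemma card_inter_insert_erase {j p : ℕ} {A B : Finset ℕ} (hjA : j ∉ A) :
    (A ∩ insert j (B.erase p)).card = ((A ∩ B).erase p).card := by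
  congr 1
  ext x
  simp only [Finset.mem_inter, Finset.mem_insert, Finset.mem_erase]
  constructor
  · rintro ⟨h1, rfl | h2⟩
    · exact absurd h1 hjA
    · exact ⟨h2.1, h1, h2.2⟩
  · rintro ⟨h1, h2, h3⟩
    exact ⟨h2, Or.inr ⟨h1, h3⟩⟩

lemma TIntersecting.compressed_inter {t j p : ℕ} {U : Finset (Finset ℕ)}
    (hU : TIntersecting t U) {A B : Finset ℕ} (hA : A ∈ U) (hB : B ∈ U)
    (hpA : p ∈ A) (hjA : j ∉ A)
    (hB' : ¬ (p ∈ B ∧ j ∉ B ∧ insert j (B.erase p) ∉ U)) :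
    t ≤ (insert j (A.erase p) ∩ B).card := by
  by_cases hpB : p ∈ B
  · by_cases hjB : j ∈ B
    · have h : insert j (A.erase p) ∩ B = insert j ((A ∩ B).erase p) := by
        ext x
        simp only [Finset.mem_inter, Finset.mem_insert, Finset.mem_erase]
        constructor
        · rintro ⟨rfl | h, h2⟩ <;> tauto
        · rintro (rfl | h) <;> tauto
      rw [h, card_insert_erase_of_mem_of_notMem (Finset.mem_inter.2 ⟨hpA, hpB⟩)
        (fun h => hjA (Finset.mem_inter.1 h).1)]
      exact hU A hA B hB
    · have hB2 : insert j (B.erase p) ∈ U := by tauto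
      have h := hU A hA _ hB2
      rw [card_inter_insert_erase hjA] at h
      refine h.trans (Finset.card_le_card fun x hx => ?_)
      simp only [Finset.mem_inter, Finset.mem_insert, Finset.mem_erase] at hx ⊢
      tauto
  · refine (hU A hA B hB).trans (Finset.card_le_card fun x hx => ?_)
    simp only [Finset.mem_inter, Finset.mem_insert, Finset.mem_erase] at hx ⊢
    refine ⟨Or.inr ⟨?_, hx.1⟩, hx.2⟩
    rintro rfl
    exact hpB hx.2

/-- Compression preserves the `t`-intersecting property. -/
lemma TIntersecting.compress {t : ℕ} {U : Finset (Finset ℕ)} (hU : TIntersecting t U) (j p : ℕ) :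
    TIntersecting t (U.image (compressSet j p U)) := by
  intro A' hA' B' hB'
  obtain ⟨A, hA, rfl⟩ := Finset.mem_image.1 hA'
  obtain ⟨B, hB, rfl⟩ := Finset.mem_image.1 hB'
  unfold compressSet
  split_ifs with h1 h2 h2
  · have h : insert j (A.erase p) ∩ insert j (B.erase p) = insert j ((A ∩ B).erase p) := by
      ext x
      simp only [Finset.mem_inter, Finset.mem_insert, Finset.mem_erase]
      tauto
    rw [h, card_insert_erase_of_mem_of_notMem (Finset.mem_inter.2 ⟨h1.1, h2.1⟩)
      (fun h => h1.2.1 (Finset.mem_inter.1 h).1)]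
    exact hU A hA B hB
  · exact hU.compressed_inter hA hB h1.1 h1.2.1 h2
  · rw [Finset.inter_comm]
    exact hU.compressed_inter hB hA h2.1 h2.2.1 h1
  · exact hU A hA B hB

/-- Compression preserves the number of members of each size. -/
lemma sum_compress (g : ℕ → ℕ) (j p : ℕ) (U : Finset (Finset ℕ)) :
    ∑ E ∈ U.image (compressSet j p U), g E.card = ∑ E ∈ U, g E.card := by
  rw [Finset.sum_image (compressSet_injOn j p U)]
  simp only [card_compressSet]

/-- A compression that moves some member strictly lowers the number of members containing `p`. -/
lemma card_filter_compress_lt {j p : ℕ} {U : Finset (Finset ℕ)} {E : Finset ℕ} (hE : E ∈ U)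
    (hp : p ∈ E) (hjp : j < p) (hj : j ∉ E) (h : insert j (E.erase p) ∉ U) :
    ((U.image (compressSet j p U)).filter (p ∈ ·)).card < (U.filter (p ∈ ·)).card := by
  apply Finset.card_lt_card
  refine Finset.ssubset_iff_subset_ne.2 ⟨fun A hA => ?_, fun heq => ?_⟩
  · obtain ⟨hA, hpA⟩ := Finset.mem_filter.1 hA
    obtain ⟨B, hB, rfl⟩ := Finset.mem_image.1 hA
    unfold compressSet at hpA ⊢
    split_ifs at hpA ⊢ with h1
    · simp [hjp.ne'] at hpA
    · exact Finset.mem_filter.2 ⟨hB, hpA⟩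
  · have hE' : E ∈ (U.image (compressSet j p U)).filter (p ∈ ·) := by
      rw [heq]; exact Finset.mem_filter.2 ⟨hE, hp⟩
    obtain ⟨B, hB, hBE⟩ := Finset.mem_image.1 (Finset.mem_filter.1 hE').1
    unfold compressSet at hBE
    split_ifs at hBE with h1
    · rw [← hBE] at hj
      simp at hj
    · subst hBE
      exact h1 ⟨hp, hj, h⟩

/-- In a `t`-intersecting family compressed at `p`, two members whose union misses some `j < p`
still share `t` elements other than `p`: otherwise, moving `p` to `j` in one of them would leave
too small an intersection. -/
lemma TIntersecting.le_card_inter_erase {t j p : ℕ} {U : Finset (Finset ℕ)}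
    (hU : TIntersecting t U) (hc : CompressedAt p U) {A B : Finset ℕ} (hA : A ∈ U) (hB : B ∈ U)
    (hpB : p ∈ B) (hjp : j < p) (hjA : j ∉ A) (hjB : j ∉ B) :
    t ≤ ((A ∩ B).erase p).card := by
  rw [← card_inter_insert_erase hjA]
  exact hU A hA _ (hc B hB hpB j hjp hjB)

/-! ### Exchanges -/

/-- Dropping the members in `R` and removing `p` from those in `T` keeps a family `t`-intersecting,
if the members of `T` share `t` elements other than `p` with every remaining member from which `p`
cannot be removed within the family. -/
lemma TIntersecting.exchange {t p : ℕ} {V T R : Finset (Finset ℕ)} (hV : TIntersecting t V)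
    (hTV : T ⊆ V) (hTR : Disjoint T R) (hT : ∀ E ∈ T, p ∈ E ∧ E.erase p ∉ V)
    (h : ∀ A ∈ T, ∀ B ∈ V, B ∉ R → p ∈ B → B.erase p ∉ V → t ≤ ((A ∩ B).erase p).card) :
    TIntersecting t ((V \ R) ∪ T.image (·.erase p)) := by
  have key : ∀ A ∈ T, ∀ B ∈ V \ R, t ≤ (A.erase p ∩ B).card := by
    intro A hA B hB
    obtain ⟨hB, hBR⟩ := Finset.mem_sdiff.1 hB
    rw [Finset.erase_inter]
    by_cases hpB : p ∈ B
    · by_cases hB' : B.erase p ∈ V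
      · have := hV A (hTV hA) _ hB'
        rwa [Finset.inter_erase] at this
      · exact h A hA B hB hBR hpB hB'
    · rw [Finset.erase_eq_of_notMem (fun h => hpB (Finset.mem_inter.1 h).2)]
      exact hV A (hTV hA) B hB
  intro A hA B hB
  rcases Finset.mem_union.1 hA with hA | hA <;> rcases Finset.mem_union.1 hB with hB | hB
  · exact hV A (Finset.mem_sdiff.1 hA).1 B (Finset.mem_sdiff.1 hB).1
  · obtain ⟨B, hB', rfl⟩ := Finset.mem_image.1 hB
    rw [Finset.inter_comm]
    exact key B hB' A hA
  · obtain ⟨A, hA', rfl⟩ := Finset.mem_image.1 hA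
    exact key A hA' B hB
  · obtain ⟨A, hA', rfl⟩ := Finset.mem_image.1 hA
    obtain ⟨B, hB', rfl⟩ := Finset.mem_image.1 hB
    have h2 : A.erase p ∩ B.erase p = (A ∩ B).erase p := by
      ext x; simp only [Finset.mem_inter, Finset.mem_erase]; tauto
    simp only [h2]
    exact h A hA' B (hTV hB') (Finset.disjoint_left.1 hTR hB') (hT B hB').1 (hT B hB').2

lemma sum_exchange (g : ℕ → ℕ) {p : ℕ} {V T R : Finset (Finset ℕ)} (hRV : R ⊆ V)
    (hT : ∀ E ∈ T, p ∈ E ∧ E.erase p ∉ V) :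
    ∑ E ∈ (V \ R) ∪ T.image (·.erase p), g E.card + ∑ E ∈ R, g E.card
      = ∑ E ∈ V, g E.card + ∑ E ∈ T, g (E.card - 1) := by
  rw [Finset.sum_union, Finset.sum_image]
  · have h : ∑ E ∈ T, g (E.erase p).card = ∑ E ∈ T, g (E.card - 1) :=
      Finset.sum_congr rfl fun E hE => by rw [Finset.card_erase_of_mem (hT E hE).1]
    rw [h, ← Finset.sum_sdiff hRV]
    ring
  · intro A hA B hB h
    rw [← Finset.insert_erase (hT A hA).1, ← Finset.insert_erase (hT B hB).1]
    exact congrArg (insert p) h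
  · rw [Finset.disjoint_left]
    intro A hA hA'
    obtain ⟨B, hB, rfl⟩ := Finset.mem_image.1 hA'
    exact (hT B hB).2 (Finset.mem_sdiff.1 hA).1

/-! ### Weights of the exchanged sets -/

/-- The number of ways to extend a set of `a` elements to one of `k` elements by adding some of
`N` further elements; it is `0` if `k < a`. -/
def extensionCount (N k a : ℕ) : ℕ := if a ≤ k then N.choose (k - a) else 0

lemma extensionCount_succ_add (N k a : ℕ) :
    extensionCount N k (a + 1) + extensionCount N k a = extensionCount (N + 1) k a := by
  unfold extensionCount
  rcases lt_trichotomy a k with h | rfl | h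
  · obtain ⟨d, rfl⟩ : ∃ d, k = a + 1 + d := ⟨k - (a + 1), by omega⟩
    rw [if_pos (by omega), if_pos (by omega), if_pos (by omega),
      show a + 1 + d - (a + 1) = d by omega, show a + 1 + d - a = d + 1 by omega,
      Nat.choose_succ_succ]
  · simp
  · rw [if_neg (by omega), if_neg (by omega), if_neg (by omega)]

lemma choose_mul_choose_le {N u v : ℕ} (h : u + v + 1 ≤ N) :
    N.choose u * N.choose v ≤ N.choose (u + 1) * N.choose (v + 1) := by
  have h1 := Nat.choose_succ_right_eq N u
  have h2 := Nat.choose_succ_right_eq N v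
  have h3 : (u + 1) * (v + 1) ≤ (N - u) * (N - v) := by
    rw [mul_comm]
    exact Nat.mul_le_mul (by omega) (by omega)
  refine Nat.le_of_mul_le_mul_right ?_ (show 0 < (u + 1) * (v + 1) by positivity)
  calc N.choose u * N.choose v * ((u + 1) * (v + 1))
      ≤ N.choose u * N.choose v * ((N - u) * (N - v)) := Nat.mul_le_mul_left _ h3
    _ = (N.choose u * (N - u)) * (N.choose v * (N - v)) := by ring
    _ = N.choose (u + 1) * N.choose (v + 1) * ((u + 1) * (v + 1)) := by rw [← h1, ← h2]; ring

/-- Consider a class of `x` sets of size `a` and a class of `y` sets of size `b`. If removing an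
element from the sets of size `a` at the cost of dropping those of size `b` lowers the total weight,
then the opposite exchange increases it. -/
lemma exchange_of_size_ne {N k a b x y s : ℕ} (ha : 1 ≤ a) (hab : a < b) (hs : a + b = s)
    (hN : 2 * k + 1 ≤ N + s)
    (h1 : x * extensionCount N k (a - 1) < y * extensionCount N k b) :
    x * extensionCount N k a < y * extensionCount N k (b - 1) := by
  unfold extensionCount at *
  have hbk : b ≤ k := by
    by_contra hbk
    rw [if_neg hbk] at h1
    simp at h1
  rw [if_pos (by omega), if_pos hbk, show k - (a - 1) = k - a + 1 by omega] at h1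
  rw [if_pos (by omega), if_pos (by omega), show k - (b - 1) = k - b + 1 by omega]
  have h2 : N.choose (k - a) * N.choose (k - b)
      ≤ N.choose (k - a + 1) * N.choose (k - b + 1) := choose_mul_choose_le (by omega)
  have hy : 0 < y := by
    rcases Nat.eq_zero_or_pos y with rfl | h
    · simp at h1
    · exact h
  have hpa : 0 < N.choose (k - a + 1) := Nat.choose_pos (by omega)
  have hpb : 0 < N.choose (k - b + 1) := Nat.choose_pos (by omega)
  rcases Nat.eq_zero_or_pos (N.choose (k - a)) with h0 | h0
  · rw [h0, mul_zero]
    positivity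
  · refine Nat.lt_of_mul_lt_mul_right (a := N.choose (k - a + 1)) ?_
    calc x * N.choose (k - a) * N.choose (k - a + 1)
        = x * N.choose (k - a + 1) * N.choose (k - a) := by ring
      _ < y * N.choose (k - b) * N.choose (k - a) := Nat.mul_lt_mul_of_pos_right h1 h0
      _ = y * (N.choose (k - a) * N.choose (k - b)) := by ring
      _ ≤ y * (N.choose (k - a + 1) * N.choose (k - b + 1)) := Nat.mul_le_mul_left _ h2
      _ = y * N.choose (k - b + 1) * N.choose (k - a + 1) := by ring

/-- If among `x + y` sets of size `t + e` in a ground set of `t + 2 * e` elements the share of `x`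
is at least the average share of the sets that avoid a given element, then removing an element
from these `x` sets at the cost of dropping the other `y` does not lower the total weight. This
is where the bound `(t + 1) * (k - t + 1) ≤ n` is needed. -/
lemma exchange_of_size_eq {N k t e x y : ℕ} (ht : 1 ≤ t) (he : 1 ≤ e) (htk : t ≤ k)
    (hN : (t + 1) * (k - t + 1) ≤ N + (t + 2 * e)) (hxy : y * e ≤ x * (t + e - 1)) :
    y * extensionCount N k (t + e) ≤ x * extensionCount N k (t + e - 1) := by
  unfold extensionCount
  by_cases hk : t + e ≤ k
  swap
  · rw [if_neg hk]
    simp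
  rw [if_pos hk, if_pos (by omega), show k - (t + e - 1) = k - (t + e) + 1 by omega]
  obtain ⟨u, rfl⟩ : ∃ u, k = t + e + u := ⟨k - (t + e), by omega⟩
  obtain ⟨s, rfl⟩ : ∃ s, t = s + 1 := ⟨t - 1, by omega⟩
  obtain ⟨d, rfl⟩ : ∃ d, e = d + 1 := ⟨e - 1, by omega⟩
  rw [show s + 1 + (d + 1) + u - (s + 1 + (d + 1)) = u by omega]
  rw [show s + 1 + (d + 1) + u - (s + 1) + 1 = u + d + 2 by omega] at hN
  rw [show s + 1 + (d + 1) - 1 = s + d + 1 by omega] at hxy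
  have h1 := Nat.choose_succ_right_eq N u
  obtain ⟨w, rfl⟩ : ∃ w, N = u + w := ⟨N - u, by nlinarith [Nat.sub_add_cancel (show u ≤ N by
    nlinarith [Nat.zero_le (s * u), Nat.zero_le (s * d)])]⟩
  rw [show u + w - u = w by omega] at h1
  have h2 : (s + d + 1) * (u + 1) ≤ (d + 1) * w := by
    have h3 : s * u + s * d + s + u + 1 ≤ w := by nlinarith
    nlinarith [Nat.mul_le_mul_left (d + 1) h3, Nat.zero_le (s * d * u), Nat.zero_le (s * d * d),
      Nat.zero_le (s * d)]
  refine Nat.le_of_mul_le_mul_right ?_ (show 0 < (d + 1) * (u + 1) by positivity)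
  calc y * (u + w).choose u * ((d + 1) * (u + 1))
      = (y * (d + 1)) * ((u + 1) * (u + w).choose u) := by ring
    _ ≤ (x * (s + d + 1)) * ((u + 1) * (u + w).choose u) := Nat.mul_le_mul_right _ hxy
    _ = x * (u + w).choose u * ((s + d + 1) * (u + 1)) := by ring
    _ ≤ x * (u + w).choose u * ((d + 1) * w) := Nat.mul_le_mul_left _ h2
    _ = x * ((u + w).choose u * w) * (d + 1) := by ring
    _ = x * (u + w).choose (u + 1) * ((d + 1) * (u + 1)) := by rw [← h1]; ring

/-! ### Extremal families -/

/-- Among the `t`-intersecting families on `{0, …, p}` there is one that maximizes a first weight,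
subject to this a second weight, and is compressed at `p`. -/
lemma exists_extremal_family {t p : ℕ} (w₁ w₂ : ℕ → ℕ) {U : Finset (Finset ℕ)}
    (hUp : U ⊆ (Finset.range (p + 1)).powerset) (hU : TIntersecting t U) :
    ∃ V ⊆ (Finset.range (p + 1)).powerset, TIntersecting t V ∧ CompressedAt p V ∧
      ∑ E ∈ U, w₁ E.card ≤ ∑ E ∈ V, w₁ E.card ∧
      ∀ V' ⊆ (Finset.range (p + 1)).powerset, TIntersecting t V' →
        ∑ E ∈ V', w₁ E.card ≤ ∑ E ∈ V, w₁ E.card ∧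
        (∑ E ∈ V, w₁ E.card = ∑ E ∈ V', w₁ E.card →
          ∑ E ∈ V', w₂ E.card ≤ ∑ E ∈ V, w₂ E.card) := by
  classical
  let S := (Finset.range (p + 1)).powerset.powerset.filter (TIntersecting t)
  have hS : ∀ V, V ∈ S ↔ V ⊆ (Finset.range (p + 1)).powerset ∧ TIntersecting t V := by
    intro V
    simp only [S, Finset.mem_filter, Finset.mem_powerset]
  have hne : S.Nonempty := ⟨U, (hS U).2 ⟨hUp, hU⟩⟩
  obtain ⟨W, hW, hWmax⟩ := S.exists_max_image
    (fun V => toLex (∑ E ∈ V, w₁ E.card, ∑ E ∈ V, w₂ E.card)) hne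
  have hne' : (S.filter fun V => ∑ E ∈ V, w₁ E.card = ∑ E ∈ W, w₁ E.card ∧
      ∑ E ∈ V, w₂ E.card = ∑ E ∈ W, w₂ E.card).Nonempty :=
    ⟨W, Finset.mem_filter.2 ⟨hW, rfl, rfl⟩⟩
  obtain ⟨V, hV, hVmin⟩ := Finset.exists_min_image _ (fun V => (V.filter (p ∈ ·)).card) hne'
  obtain ⟨hVS, hV1, hV2⟩ := Finset.mem_filter.1 hV
  obtain ⟨hVp, hVt⟩ := (hS V).1 hVS
  have hmax : ∀ V' ⊆ (Finset.range (p + 1)).powerset, TIntersecting t V' →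
        ∑ E ∈ V', w₁ E.card ≤ ∑ E ∈ V, w₁ E.card ∧
        (∑ E ∈ V, w₁ E.card = ∑ E ∈ V', w₁ E.card →
          ∑ E ∈ V', w₂ E.card ≤ ∑ E ∈ V, w₂ E.card) := by
    intro V' hV'p hV't
    have := hWmax V' ((hS V').2 ⟨hV'p, hV't⟩)
    rw [Prod.Lex.toLex_le_toLex] at this
    rw [hV1, hV2]
    simp only at this
    refine ⟨by omega, by omega⟩
  refine ⟨V, hVp, hVt, ?_, (hmax U hUp hU).1, hmax⟩
  intro E hE hpE j hj hjE
  by_contra hcon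
  have hlt := card_filter_compress_lt hE hpE hj hjE hcon
  refine absurd (hVmin _ (Finset.mem_filter.2 ⟨(hS _).2 ⟨?_, hVt.compress j p⟩, ?_, ?_⟩))
    (not_le.2 hlt)
  · intro A' hA'
    obtain ⟨A, hA, rfl⟩ := Finset.mem_image.1 hA'
    have hAp := Finset.mem_powerset.1 (hVp hA)
    unfold compressSet
    split_ifs
    · refine Finset.mem_powerset.2 (Finset.insert_subset (Finset.mem_range.2 (by omega)) ?_)
      exact (Finset.erase_subset _ _).trans hAp
    · exact hVp hA
  · rw [sum_compress, hV1]
  · rw [sum_compress, hV2]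

/-- A weight on the subsets of `{0, …, p}`, depending on the cardinality only, for which a single
set outweighs all sets of larger size together. -/
def steepWeight (p a : ℕ) : ℕ := (2 ^ (p + 1) + 1) ^ (p + 1 - a)

lemma sum_steepWeight_lt {p a : ℕ} {T R : Finset (Finset ℕ)}
    (hR : R ⊆ (Finset.range (p + 1)).powerset) (ha : 1 ≤ a) (hap : a ≤ p + 1)
    (hT : T.Nonempty) (hTa : ∀ E ∈ T, E.card = a) (hRa : ∀ E ∈ R, a ≤ E.card) :
    ∑ E ∈ R, steepWeight p E.card < ∑ E ∈ T, steepWeight p (E.card - 1) := by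
  have hcard : R.card ≤ 2 ^ (p + 1) := by
    simpa using Finset.card_le_card hR
  have h1 : ∑ E ∈ R, steepWeight p E.card ≤ R.card * (2 ^ (p + 1) + 1) ^ (p + 1 - a) := by
    rw [← smul_eq_mul]
    refine Finset.sum_le_card_nsmul _ _ _ fun E hE => ?_
    exact Nat.pow_le_pow_right (by positivity) (by have := hRa E hE; omega)
  have h2 : ∑ E ∈ T, steepWeight p (E.card - 1) = T.card * (2 ^ (p + 1) + 1) ^ (p + 1 - a + 1) := by
    rw [← smul_eq_mul]
    refine Finset.sum_eq_card_nsmul fun E hE => ?_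
    rw [hTa E hE, steepWeight]
    congr 1
    omega
  rw [h2]
  refine h1.trans_lt ?_
  have h3 : 0 < (2 ^ (p + 1) + 1) ^ (p + 1 - a) := by positivity
  calc R.card * (2 ^ (p + 1) + 1) ^ (p + 1 - a)
      < (2 ^ (p + 1) + 1) * (2 ^ (p + 1) + 1) ^ (p + 1 - a) :=
        Nat.mul_lt_mul_of_pos_right (by omega) h3
    _ = 1 * (2 ^ (p + 1) + 1) ^ (p + 1 - a + 1) := by rw [pow_succ]; ring
    _ ≤ T.card * (2 ^ (p + 1) + 1) ^ (p + 1 - a + 1) :=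
        Nat.mul_le_mul_right _ (Finset.card_pos.2 hT)

/-- Two members of a compressed `t`-intersecting family on `{0, …, p}` that contain `p` but do not
share `t` other elements cover the ground set, so their sizes add up to `p + 1 + t`. -/
lemma TIntersecting.card_add_card {t p : ℕ} {V : Finset (Finset ℕ)}
    (hVp : V ⊆ (Finset.range (p + 1)).powerset) (hV : TIntersecting t V)
    (hc : CompressedAt p V) {A B : Finset ℕ} (hA : A ∈ V) (hB : B ∈ V) (hpA : p ∈ A)
    (hpB : p ∈ B) (h : ((A ∩ B).erase p).card < t) : A.card + B.card = p + 1 + t := by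
  have hcov : A ∪ B = Finset.range (p + 1) := by
    refine Finset.Subset.antisymm (Finset.union_subset (Finset.mem_powerset.1 (hVp hA))
      (Finset.mem_powerset.1 (hVp hB))) fun j hj => ?_
    by_contra hcon
    rw [Finset.mem_union, not_or] at hcon
    have hjp : j ≠ p := by rintro rfl; exact hcon.1 hpA
    have := hV.le_card_inter_erase hc hA hB hpB
      (by have := Finset.mem_range.1 hj; omega) hcon.1 hcon.2
    omega
  have h1 := Finset.card_union_add_card_inter A B
  rw [hcov, Finset.card_range] at h1
  have h2 := Finset.card_erase_add_one (Finset.mem_inter.2 ⟨hpA, hpB⟩)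
  have h3 := hV A hA B hB
  omega

/-- Among sets of size `a` that contain `p` and lie in `{0, …, p}`, the average share of the sets
that avoid a given `x < p` is `(p + 1 - a) / p`. -/
lemma exists_avoided_element {p a : ℕ} (hp : 1 ≤ p) {H : Finset (Finset ℕ)}
    (hHp : ∀ E ∈ H, E ⊆ Finset.range (p + 1)) (hH : ∀ E ∈ H, p ∈ E) (hHa : ∀ E ∈ H, E.card = a) :
    ∃ x < p, H.card * (p + 1 - a) ≤ (H.filter (x ∉ ·)).card * p := by
  by_contra! hcon
  have hcount : ∑ x ∈ Finset.range p, (H.filter (x ∉ ·)).card = H.card * (p + 1 - a) := by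
    simp only [Finset.card_filter]
    rw [Finset.sum_comm, ← smul_eq_mul]
    refine Finset.sum_eq_card_nsmul fun E hE => ?_
    rw [← Finset.card_filter]
    have h1 : (Finset.range p).filter (· ∉ E) = Finset.range (p + 1) \ E := by
      ext x
      simp only [Finset.mem_filter, Finset.mem_range, Finset.mem_sdiff]
      refine ⟨fun h => ⟨by omega, h.2⟩, fun h => ⟨?_, h.2⟩⟩
      have : x ≠ p := by rintro rfl; exact h.2 (hH E hE)
      omega
    rw [h1, Finset.card_sdiff_of_subset (hHp E hE), Finset.card_range, hHa E hE]
  have h2 : ∑ x ∈ Finset.range p, (H.filter (x ∉ ·)).card * p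
      < ∑ x ∈ Finset.range p, H.card * (p + 1 - a) :=
    Finset.sum_lt_sum_of_nonempty ⟨0, Finset.mem_range.2 (by omega)⟩
      fun x hx => hcon x (Finset.mem_range.1 hx)
  rw [← Finset.sum_mul, hcount, Finset.sum_const, Finset.card_range, smul_eq_mul, mul_comm] at h2
  exact lt_irrefl _ h2

/-- The heart of the matter: a `t`-intersecting family on `{0, …, p}` that is extremal for the
extension count, and among these for the steep weight, remains stable under removing `p` from its
members. Otherwise one of the exchanges would improve it. -/
lemma erase_mem_of_extremal {n k t p : ℕ} (ht : 1 ≤ t) (htk : t ≤ k) (htp : t ≤ p)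
    (hpn : p + 1 ≤ n) (hn : (t + 1) * (k - t + 1) ≤ n) {V : Finset (Finset ℕ)}
    (hVp : V ⊆ (Finset.range (p + 1)).powerset) (hV : TIntersecting t V)
    (hc : CompressedAt p V)
    (hmax : ∀ V' ⊆ (Finset.range (p + 1)).powerset, TIntersecting t V' →
        ∑ E ∈ V', extensionCount (n - (p + 1)) k E.card
          ≤ ∑ E ∈ V, extensionCount (n - (p + 1)) k E.card ∧
        (∑ E ∈ V, extensionCount (n - (p + 1)) k E.card
          = ∑ E ∈ V', extensionCount (n - (p + 1)) k E.card →
          ∑ E ∈ V', steepWeight p E.card ≤ ∑ E ∈ V, steepWeight p E.card)) :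
    ∀ E ∈ V, p ∈ E → E.erase p ∈ V := by
  classical
  set c := extensionCount (n - (p + 1)) k with hcdef
  -- the members of size `a` from which `p` cannot be removed
  let G : ℕ → Finset (Finset ℕ) := fun a => V.filter fun E => (p ∈ E ∧ E.erase p ∉ V) ∧ E.card = a
  have hG : ∀ a E, E ∈ G a ↔ E ∈ V ∧ (p ∈ E ∧ E.erase p ∉ V) ∧ E.card = a := fun a E =>
    Finset.mem_filter
  have hexch : ∀ T R : Finset (Finset ℕ), T ⊆ V → R ⊆ V → Disjoint T R →
      (∀ E ∈ T, p ∈ E ∧ E.erase p ∉ V) →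
      (∀ A ∈ T, ∀ B ∈ V, B ∉ R → p ∈ B → B.erase p ∉ V → t ≤ ((A ∩ B).erase p).card) →
      ∑ E ∈ T, c (E.card - 1) ≤ ∑ E ∈ R, c E.card ∧
      (∑ E ∈ R, c E.card ≤ ∑ E ∈ T, c (E.card - 1) →
        ∑ E ∈ T, steepWeight p (E.card - 1) ≤ ∑ E ∈ R, steepWeight p E.card) := by
    intro T R hTV hRV hTR hT h
    have h1 := sum_exchange c hRV hT
    have h2 := sum_exchange (steepWeight p) hRV hT
    have h3 := hmax ((V \ R) ∪ T.image (·.erase p)) ?_ (hV.exchange hTV hTR hT h)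
    · omega
    · refine Finset.union_subset (Finset.sdiff_subset.trans hVp) fun A hA => ?_
      obtain ⟨B, hB, rfl⟩ := Finset.mem_image.1 hA
      exact Finset.mem_powerset.2 ((Finset.erase_subset _ _).trans
        (Finset.mem_powerset.1 (hVp (hTV hB))))
  have hsum : ∀ (w : ℕ → ℕ) (a : ℕ), ∑ E ∈ G a, w E.card = (G a).card * w a := fun w a => by
    rw [← smul_eq_mul]
    exact Finset.sum_eq_card_nsmul fun E hE => by rw [((hG a E).1 hE).2.2]
  have hpair : ∀ a b, a ≠ b → a + b = p + 1 + t →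
      (G a).card * c (a - 1) ≤ (G b).card * c b ∧
      ((G b).card * c b ≤ (G a).card * c (a - 1) →
        ∑ E ∈ G a, steepWeight p (E.card - 1) ≤ ∑ E ∈ G b, steepWeight p E.card) := by
    intro a b hab hs
    rw [← hsum c b, ← hsum (fun a => c (a - 1)) a]
    refine hexch (G a) (G b) (Finset.filter_subset _ _) (Finset.filter_subset _ _) ?_
      (fun E hE => ((hG a E).1 hE).2.1) ?_
    · rw [Finset.disjoint_left]
      intro E hE hE'
      exact hab (((hG a E).1 hE).2.2.symm.trans ((hG b E).1 hE').2.2)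
    · intro A hA B hB hBR hpB hB'
      obtain ⟨hA, hA', hAa⟩ := (hG a A).1 hA
      by_contra! hcon
      have := hV.card_add_card hVp hc hA hB hA'.1 hpB hcon
      exact hBR ((hG b B).2 ⟨hB, ⟨hpB, hB'⟩, by omega⟩)
  have hGpos : ∀ a, (G a).Nonempty → 1 ≤ a ∧ a ≤ p + 1 := by
    rintro a ⟨E, hE⟩
    obtain ⟨hEV, hE', rfl⟩ := (hG a E).1 hE
    refine ⟨Finset.card_pos.2 ⟨p, hE'.1⟩, ?_⟩
    simpa using Finset.card_le_card (Finset.mem_powerset.1 (hVp hEV))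
  have hN : 2 * k + 1 ≤ n + t := by
    obtain ⟨s, rfl⟩ : ∃ s, t = s + 1 := ⟨t - 1, by omega⟩
    obtain ⟨d, rfl⟩ : ∃ d, k = s + 1 + d := ⟨k - (s + 1), by omega⟩
    rw [show s + 1 + d - (s + 1) = d by omega] at hn
    nlinarith [Nat.zero_le (s * d)]
  have hlt : ∀ a b, a < b → a + b = p + 1 + t → G a = ∅ := by
    intro a b hab hs
    rw [← Finset.not_nonempty_iff_eq_empty]
    intro hne
    obtain ⟨h1, h2⟩ := hpair a b hab.ne hs
    obtain ⟨h3, -⟩ := hpair b a hab.ne' (by omega)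
    have h4 : ∑ E ∈ G b, steepWeight p E.card < ∑ E ∈ G a, steepWeight p (E.card - 1) :=
      sum_steepWeight_lt ((Finset.filter_subset _ _).trans hVp) (hGpos a hne).1 (hGpos a hne).2
        hne (fun E hE => ((hG a E).1 hE).2.2)
        (fun E hE => by rw [((hG b E).1 hE).2.2]; exact hab.le)
    have h5 : (G a).card * c (a - 1) < (G b).card * c b := by
      by_contra! hcon
      exact absurd (h2 hcon) (not_le.2 h4)
    exact absurd h3 (not_le.2 (exchange_of_size_ne (hGpos a hne).1 hab hs (by omega) h5))
  have hne : ∀ a b, a ≠ b → a + b = p + 1 + t → G a = ∅ := by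
    intro a b hab hs
    rcases lt_or_gt_of_ne hab with h | h
    · exact hlt a b h hs
    · rw [← Finset.not_nonempty_iff_eq_empty]
      intro hne
      have h1 := (hpair a b hab hs).2
      have h2 := sum_steepWeight_lt (p := p) (R := ∅) (Finset.empty_subset _) (hGpos a hne).1
        (hGpos a hne).2 hne (fun E hE => ((hG a E).1 hE).2.2) (by simp)
      rw [hlt b a h (by omega)] at h1
      simp only [Finset.card_empty, zero_mul, zero_le, true_implies] at h1
      exact absurd h1 (not_le.2 h2)
  intro E₀ hE₀ hpE₀
  by_contra hE₀'
  obtain ⟨a, ha⟩ : ∃ a, E₀ ∈ G a := ⟨E₀.card, (hG _ _).2 ⟨hE₀, ⟨hpE₀, hE₀'⟩, rfl⟩⟩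
  obtain ⟨ha1, hap⟩ := hGpos a ⟨E₀, ha⟩
  have haa : a + a = p + 1 + t := by
    by_contra hcon
    have := hne a (p + 1 + t - a) (by omega) (by omega)
    rw [this] at ha
    simp at ha
  obtain ⟨x, hxp, hx⟩ := exists_avoided_element (p := p) (a := a) (H := G a) (by omega)
    (fun E hE => Finset.mem_powerset.1 (hVp ((hG a E).1 hE).1))
    (fun E hE => ((hG a E).1 hE).2.1.1) (fun E hE => ((hG a E).1 hE).2.2)
  set T := (G a).filter (x ∉ ·) with hTdef
  have hTG : T ⊆ G a := Finset.filter_subset _ _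
  have hGV : G a ⊆ V := Finset.filter_subset _ _
  have hTne : T.Nonempty := by
    rw [← Finset.card_pos]
    have h1 : 0 < (G a).card * (p + 1 - a) :=
      Nat.mul_pos (Finset.card_pos.2 ⟨E₀, ha⟩) (by omega)
    exact Nat.pos_of_mul_pos_right (h1.trans_le hx)
  obtain ⟨-, h2⟩ := hexch T (G a \ T) (hTG.trans hGV) (Finset.sdiff_subset.trans hGV)
    Finset.disjoint_sdiff (fun E hE => ((hG a E).1 (hTG hE)).2.1) (by
      intro A hA B hB hBR hpB hB'
      obtain ⟨hAG, hxA⟩ := Finset.mem_filter.1 hA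
      obtain ⟨hAV, hA', hAa⟩ := (hG a A).1 hAG
      by_contra! hcon
      have h3 := hV.card_add_card hVp hc hAV hB hA'.1 hpB hcon
      have hBG : B ∈ G a := (hG a B).2 ⟨hB, ⟨hpB, hB'⟩, by omega⟩
      have hBT : B ∈ T := by
        by_contra hBT
        exact hBR (Finset.mem_sdiff.2 ⟨hBG, hBT⟩)
      -- as `x` lies in neither set, they do not cover the ground set
      have h4 := hV.le_card_inter_erase hc hAV hB hpB hxp hxA (Finset.mem_filter.1 hBT).2
      omega)
  refine absurd (h2 ?_) (not_le.2 (sum_steepWeight_lt ((Finset.sdiff_subset.trans hGV).trans hVp)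
    ha1 hap hTne (fun E hE => ((hG a E).1 (hTG hE)).2.2)
    fun E hE => ((hG a E).1 (Finset.mem_sdiff.1 hE).1).2.2.ge))
  have hs1 : ∑ E ∈ G a \ T, c E.card = (G a \ T).card * c a := by
    rw [← smul_eq_mul]
    exact Finset.sum_eq_card_nsmul fun E hE => by rw [((hG a E).1 (Finset.mem_sdiff.1 hE).1).2.2]
  have hs2 : ∑ E ∈ T, c (E.card - 1) = T.card * c (a - 1) := by
    rw [← smul_eq_mul]
    exact Finset.sum_eq_card_nsmul fun E hE => by rw [((hG a E).1 (hTG hE)).2.2]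
  rw [hs1, hs2]
  obtain ⟨e, rfl⟩ : ∃ e, a = t + e := ⟨a - t, by omega⟩
  have hp : p = t + e - 1 + e := by omega
  have hcard : (G (t + e) \ T).card + T.card = (G (t + e)).card :=
    Finset.card_sdiff_add_card_eq_card hTG
  rw [← hcard, show p + 1 - (t + e) = e by omega, hp] at hx
  exact exchange_of_size_eq ht (by omega) htk (by omega) (by nlinarith)

/-! ### The theorem of Frankl and Wilson -/

/-- A weighted form of the theorem of Frankl and Wilson: a `t`-intersecting family on
`{0, …, m - 1}` has at most `(n - t).choose (k - t)` extensions to `k`-subsets of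
`{0, …, n - 1}`. -/
lemma sum_extensionCount_le {n k t m : ℕ} (ht : 1 ≤ t) (htk : t ≤ k)
    (hn : (t + 1) * (k - t + 1) ≤ n) (htm : t ≤ m) (hmn : m ≤ n) {U : Finset (Finset ℕ)}
    (hUm : U ⊆ (Finset.range m).powerset) (hU : TIntersecting t U) :
    ∑ E ∈ U, extensionCount (n - m) k E.card ≤ (n - t).choose (k - t) := by
  induction m, htm using Nat.le_induction generalizing U with
  | base =>
    have h1 : U ⊆ {Finset.range t} := by
      intro A hA
      rw [Finset.mem_singleton]
      refine Finset.eq_of_subset_of_card_le (Finset.mem_powerset.1 (hUm hA)) ?_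
      have := hU A hA A hA
      rwa [Finset.inter_self, ← Finset.card_range t] at this
    refine (Finset.sum_le_sum_of_subset h1).trans ?_
    simp [extensionCount, htk]
  | succ p htp ih =>
    obtain ⟨V, hVp, hV, hc, hUV, hmax⟩ :=
      exists_extremal_family (extensionCount (n - (p + 1)) k) (steepWeight p) hUm hU
    have herase := erase_mem_of_extremal ht htk htp hmn hn hVp hV hc hmax
    refine hUV.trans (le_trans ?_ (ih (by omega) (U := V.filter (p ∉ ·)) ?_ ?_))
    · rw [← Finset.sum_filter_add_sum_filter_not V (p ∈ ·)]
      rw [show n - p = n - (p + 1) + 1 by omega]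
      simp only [← extensionCount_succ_add]
      rw [Finset.sum_add_distrib]
      refine Nat.add_le_add_right ?_ _
      have hinj : Set.InjOn (fun E : Finset ℕ => E.erase p) (V.filter (p ∈ ·)) :=
          (Finset.erase_injOn' p).mono fun E hE => (Finset.mem_filter.1 hE).2
      have h1 : ∑ E ∈ V.filter (p ∈ ·), extensionCount (n - (p + 1)) k E.card
          = ∑ E ∈ (V.filter (p ∈ ·)).image (·.erase p),
            extensionCount (n - (p + 1)) k (E.card + 1) := by
        rw [Finset.sum_image hinj]
        refine Finset.sum_congr rfl fun E hE => ?_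
        rw [Finset.card_erase_add_one (Finset.mem_filter.1 hE).2]
      rw [h1]
      refine Finset.sum_le_sum_of_subset fun A hA => ?_
      obtain ⟨B, hB, rfl⟩ := Finset.mem_image.1 hA
      obtain ⟨hB, hpB⟩ := Finset.mem_filter.1 hB
      exact Finset.mem_filter.2 ⟨herase B hB hpB, Finset.notMem_erase _ _⟩
    · intro A hA
      obtain ⟨hA, hpA⟩ := Finset.mem_filter.1 hA
      refine Finset.mem_powerset.2 fun x hx => ?_
      have h1 := Finset.mem_range.1 (Finset.mem_powerset.1 (hVp hA) hx)
      have h2 : x ≠ p := by rintro rfl; exact hpA hx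
      exact Finset.mem_range.2 (by omega)
    · exact fun A hA B hB => hV A (Finset.mem_filter.1 hA).1 B (Finset.mem_filter.1 hB).1

/-- The theorem of Frankl and Wilson, with the optimal bound on `n`. -/
theorem TIntersecting.card_le_choose {n k t : ℕ} (ht : 1 ≤ t) (htk : t ≤ k)
    (hn : (t + 1) * (k - t + 1) ≤ n) {U : Finset (Finset ℕ)}
    (hUn : U ⊆ (Finset.range n).powersetCard k) (hU : TIntersecting t U) :
    U.card ≤ (n - t).choose (k - t) := by
  have htn : t ≤ n := by nlinarith [Nat.zero_le (k - t), Nat.zero_le (t * (k - t))]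
  have h := sum_extensionCount_le ht htk hn htn le_rfl
    (fun A hA => Finset.mem_powerset.2 (Finset.mem_powersetCard.1 (hUn hA)).1) hU
  rwa [Finset.sum_congr rfl (g := fun _ => 1) fun E hE => by
    simp [extensionCount, (Finset.mem_powersetCard.1 (hUn hE)).2], Finset.sum_const,
    smul_eq_mul, mul_one] at h

/-! ### Shifted complexes on the natural numbers -/

/-- A finite family of finite sets of natural numbers is a shifted complex if it is closed under
taking subsets and under replacing an element of a member by any smaller number. It may be
empty. -/
structure IsShiftedComplex (D : Finset (Finset ℕ)) : Prop where
  mem_of_subset : ∀ F ∈ D, ∀ G ⊆ F, G ∈ D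
  shift_mem : ∀ F ∈ D, ∀ i ∈ F, ∀ j < i, insert j (F.erase i) ∈ D

/-- Every member with fewer than `k` elements can be enlarged within the family; for a simplicial
complex this says that all facets have at least `k` elements. -/
def ExtendsTo (k : ℕ) (D : Finset (Finset ℕ)) : Prop :=
  ∀ F ∈ D, F.card < k → ∃ x ∉ F, insert x F ∈ D

/-- The faces that do not contain the vertex `p`. -/
def deletion (p : ℕ) (D : Finset (Finset ℕ)) : Finset (Finset ℕ) := D.filter (p ∉ ·)

/-- The link of the vertex `p`, which is empty if `p` lies in no face. -/
def vertexLink (p : ℕ) (D : Finset (Finset ℕ)) : Finset (Finset ℕ) :=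
  D.filter fun F => p ∉ F ∧ insert p F ∈ D

lemma IsShiftedComplex.range_mem {D : Finset (Finset ℕ)} {k : ℕ} (hD : IsShiftedComplex D)
    (hk : ExtendsTo k D) (hne : D.Nonempty) {s : ℕ} (hs : s ≤ k) : Finset.range s ∈ D := by
  induction s with
  | zero =>
    obtain ⟨F, hF⟩ := hne
    exact hD.mem_of_subset F hF _ (by simp)
  | succ s ih =>
    obtain ⟨x, hx, hxD⟩ := hk _ (ih (by omega)) (by rw [Finset.card_range]; omega)
    rw [Finset.range_add_one]
    rcases (not_lt.1 (fun h => hx (Finset.mem_range.2 h))).eq_or_lt with rfl | h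
    · exact hxD
    · have := hD.shift_mem _ hxD x (Finset.mem_insert_self _ _) s h
      rwa [Finset.erase_insert hx] at this

lemma IsShiftedComplex.deletion {D : Finset (Finset ℕ)} {p : ℕ} (hD : IsShiftedComplex D)
    (hDp : ∀ F ∈ D, F ⊆ Finset.range (p + 1)) : IsShiftedComplex (deletion p D) where
  mem_of_subset F hF G hG := by
    obtain ⟨hF, hpF⟩ := Finset.mem_filter.1 hF
    exact Finset.mem_filter.2 ⟨hD.mem_of_subset F hF G hG, fun h => hpF (hG h)⟩
  shift_mem F hF i hi j hj := by
    obtain ⟨hF, hpF⟩ := Finset.mem_filter.1 hF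
    refine Finset.mem_filter.2 ⟨hD.shift_mem F hF i hi j hj, fun h => ?_⟩
    rcases Finset.mem_insert.1 h with h | h
    · have := Finset.mem_range.1 (hDp F hF hi)
      omega
    · exact hpF (Finset.mem_of_mem_erase h)

lemma IsShiftedComplex.vertexLink {D : Finset (Finset ℕ)} {p : ℕ} (hD : IsShiftedComplex D)
    (hDp : ∀ F ∈ D, F ⊆ Finset.range (p + 1)) : IsShiftedComplex (vertexLink p D) where
  mem_of_subset F hF G hG := by
    obtain ⟨hF, hpF, hF'⟩ := Finset.mem_filter.1 hF
    exact Finset.mem_filter.2 ⟨hD.mem_of_subset F hF G hG, fun h => hpF (hG h),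
      hD.mem_of_subset _ hF' _ (Finset.insert_subset_insert _ hG)⟩
  shift_mem F hF i hi j hj := by
    obtain ⟨hF, hpF, hF'⟩ := Finset.mem_filter.1 hF
    have hip : p ≠ i := by rintro rfl; exact hpF hi
    refine Finset.mem_filter.2 ⟨hD.shift_mem F hF i hi j hj, fun h => ?_, ?_⟩
    · rcases Finset.mem_insert.1 h with h | h
      · have := Finset.mem_range.1 (hDp F hF hi)
        omega
      · exact hpF (Finset.mem_of_mem_erase h)
    · have := hD.shift_mem _ hF' i (Finset.mem_insert_of_mem hi) j hj
      rwa [Finset.erase_insert_of_ne hip, Finset.insert_comm] at this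

/-- Deleting the last vertex of a shifted complex does not create smaller facets, except in a full
simplex. -/
lemma IsShiftedComplex.extendsTo_deletion {D : Finset (Finset ℕ)} {p k : ℕ}
    (hD : IsShiftedComplex D) (hDp : ∀ F ∈ D, F ⊆ Finset.range (p + 1)) (hk : ExtendsTo k D)
    (hfull : Finset.range (p + 1) ∉ D) : ExtendsTo k (_root_.deletion p D) := by
  intro F hF hFk
  obtain ⟨hF, hpF⟩ := Finset.mem_filter.1 hF
  obtain ⟨x, hx, hxD⟩ := hk F hF hFk
  by_cases hxp : x = p
  swap
  · refine ⟨x, hx, Finset.mem_filter.2 ⟨hxD, fun h => ?_⟩⟩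
    rcases Finset.mem_insert.1 h with h | h
    · exact hxp h.symm
    · exact hpF h
  subst hxp
  by_cases hj : ∃ j < x, j ∉ F
  · obtain ⟨j, hjx, hjF⟩ := hj
    refine ⟨j, hjF, Finset.mem_filter.2 ⟨?_, fun h => ?_⟩⟩
    · have := hD.shift_mem _ hxD x (Finset.mem_insert_self _ _) j hjx
      rwa [Finset.erase_insert hx] at this
    · rcases Finset.mem_insert.1 h with h | h
      · omega
      · exact hpF h
  · push Not at hj
    refine absurd (hD.mem_of_subset _ hxD _ fun y hy => ?_) hfull
    rcases (Nat.lt_succ_iff.1 (Finset.mem_range.1 hy)).eq_or_lt with rfl | h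
    · exact Finset.mem_insert_self _ _
    · exact Finset.mem_insert_of_mem (hj y h)

lemma IsShiftedComplex.extendsTo_vertexLink {D : Finset (Finset ℕ)} {p k : ℕ}
    (hD : IsShiftedComplex D) (hk : ExtendsTo k D) :
    ExtendsTo (k - 1) (_root_.vertexLink p D) := by
  intro F hF hFk
  obtain ⟨hF, hpF, hF'⟩ := Finset.mem_filter.1 hF
  obtain ⟨x, hx, hxD⟩ := hk _ hF' (by rw [Finset.card_insert_of_notMem hpF]; omega)
  rw [Finset.mem_insert, not_or] at hx
  rw [Finset.insert_comm] at hxD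
  refine ⟨x, hx.2, Finset.mem_filter.2 ⟨hD.mem_of_subset _ hxD _ (Finset.subset_insert _ _),
    fun h => ?_, hxD⟩⟩
  rcases Finset.mem_insert.1 h with h | h
  · exact hx.1 h.symm
  · exact hpF h

/-- Every `t`-intersecting family of faces of a shifted complex can be compressed within the
complex. -/
lemma IsShiftedComplex.exists_compressedAt {D A : Finset (Finset ℕ)} {t r : ℕ} (p : ℕ)
    (hD : IsShiftedComplex D) (hAD : A ⊆ D.filter (·.card = r)) (hA : TIntersecting t A) :
    ∃ B ⊆ D.filter (·.card = r), TIntersecting t B ∧ CompressedAt p B ∧ B.card = A.card := by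
  classical
  let S := (D.filter (·.card = r)).powerset.filter fun B => TIntersecting t B ∧ B.card = A.card
  have hS : S.Nonempty := ⟨A, Finset.mem_filter.2 ⟨Finset.mem_powerset.2 hAD, hA, rfl⟩⟩
  obtain ⟨B, hB, hmin⟩ := S.exists_min_image (fun B => (B.filter (p ∈ ·)).card) hS
  obtain ⟨hBD, hBt, hBA⟩ := Finset.mem_filter.1 hB
  rw [Finset.mem_powerset] at hBD
  refine ⟨B, hBD, hBt, ?_, hBA⟩
  intro E hE hpE j hj hjE
  by_contra hcon
  refine absurd (hmin _ (Finset.mem_filter.2 ⟨Finset.mem_powerset.2 ?_, hBt.compress j p, ?_⟩))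
    (not_le.2 (card_filter_compress_lt hE hpE hj hjE hcon))
  · intro C' hC'
    obtain ⟨C, hC, rfl⟩ := Finset.mem_image.1 hC'
    obtain ⟨hCD, hCr⟩ := Finset.mem_filter.1 (hBD hC)
    refine Finset.mem_filter.2 ⟨?_, by rw [card_compressSet, hCr]⟩
    unfold compressSet
    split_ifs with h
    · exact hD.shift_mem C hCD p h.1 j hj
    · exact hCD
  · rw [Finset.card_image_of_injOn (compressSet_injOn j p B), hBA]

/-- The `r`-faces containing the first `t` vertices split according to whether they contain a
further vertex `p`. -/
lemma card_deletion_add_card_vertexLink_le {D : Finset (Finset ℕ)} {t r p : ℕ} (hr : 1 ≤ r) :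
    ((deletion p D).filter fun F => Finset.range t ⊆ F ∧ F.card = r).card +
      ((vertexLink p D).filter fun F => Finset.range t ⊆ F ∧ F.card = r - 1).card
      ≤ (D.filter fun F => Finset.range t ⊆ F ∧ F.card = r).card := by
  have hinj : Set.InjOn (fun F : Finset ℕ => insert p F)
      ((vertexLink p D).filter fun F => Finset.range t ⊆ F ∧ F.card = r - 1) := by
    intro A hA B hB h
    have hpA := (Finset.mem_filter.1 (Finset.mem_filter.1 hA).1).2.1
    have hpB := (Finset.mem_filter.1 (Finset.mem_filter.1 hB).1).2.1
    rw [← Finset.erase_insert hpA, ← Finset.erase_insert hpB]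
    exact congrArg (Finset.erase · p) h
  rw [← Finset.card_image_of_injOn hinj, ← Finset.card_union_of_disjoint]
  · refine Finset.card_le_card (Finset.union_subset (fun F hF => ?_) fun F hF => ?_)
    · obtain ⟨hF, hF'⟩ := Finset.mem_filter.1 hF
      exact Finset.mem_filter.2 ⟨(Finset.mem_filter.1 hF).1, hF'⟩
    · obtain ⟨E, hE, rfl⟩ := Finset.mem_image.1 hF
      obtain ⟨hE, htE, hEr⟩ := Finset.mem_filter.1 hE
      obtain ⟨-, hpE, hE'⟩ := Finset.mem_filter.1 hE
      refine Finset.mem_filter.2 ⟨hE', htE.trans (Finset.subset_insert _ _), ?_⟩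
      rw [Finset.card_insert_of_notMem hpE]
      omega
  · rw [Finset.disjoint_left]
    intro F hF hF'
    obtain ⟨E, -, rfl⟩ := Finset.mem_image.1 hF'
    exact (Finset.mem_filter.1 (Finset.mem_filter.1 hF).1).2 (Finset.mem_insert_self _ _)

lemma choose_le_card_filter_range_subset {D : Finset (Finset ℕ)} {n t r : ℕ} (htr : t ≤ r)
    (htn : t ≤ n) (hD : ∀ F ⊆ Finset.range n, F ∈ D) :
    (n - t).choose (r - t) ≤ (D.filter fun F => Finset.range t ⊆ F ∧ F.card = r).card := by
  have hdisj : ∀ E ∈ (Finset.range n \ Finset.range t).powersetCard (r - t),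
      Disjoint (Finset.range t) E := fun E hE =>
    Finset.disjoint_of_subset_right (Finset.mem_powersetCard.1 hE).1 Finset.disjoint_sdiff
  have h1 : ((Finset.range n \ Finset.range t).powersetCard (r - t)).card
      = (n - t).choose (r - t) := by
    rw [Finset.card_powersetCard, Finset.card_sdiff_of_subset (Finset.range_mono htn),
      Finset.card_range, Finset.card_range]
  rw [← h1]
  refine Finset.card_le_card_of_injOn (fun E => Finset.range t ∪ E) (fun E hE => ?_)
    fun A hA B hB h => ?_
  · obtain ⟨hE', hEr⟩ := Finset.mem_powersetCard.1 hE
    refine Finset.mem_filter.2 ⟨hD _ (Finset.union_subset (Finset.range_mono htn)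
      (hE'.trans Finset.sdiff_subset)), Finset.subset_union_left, ?_⟩
    rw [Finset.card_union_of_disjoint (hdisj E hE), Finset.card_range]
    omega
  · rw [← Finset.union_sdiff_cancel_left (hdisj A hA), ← Finset.union_sdiff_cancel_left (hdisj B hB)]
    exact congrArg (· \ Finset.range t) h

/-- The Erdős–Ko–Rado property of shifted complexes, by induction on the number of vertices. -/
theorem IsShiftedComplex.card_le {n k t r : ℕ} (ht : 1 ≤ t) (htr : t ≤ r)
    (hkr : (t + 1) * (r - t + 1) ≤ k) {D A : Finset (Finset ℕ)} (hD : IsShiftedComplex D)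
    (hDn : ∀ F ∈ D, F ⊆ Finset.range n) (hk : ExtendsTo k D)
    (hAD : A ⊆ D.filter (·.card = r)) (hA : TIntersecting t A) :
    A.card ≤ (D.filter fun F => Finset.range t ⊆ F ∧ F.card = r).card := by
  induction n generalizing k r D A with
  | zero =>
    have hempty : D = ∅ := by
      rw [← Finset.not_nonempty_iff_eq_empty]
      intro hne
      have h1 := Finset.card_le_card (hDn _ (hD.range_mem hk hne le_rfl))
      simp only [Finset.card_range] at h1
      have : 0 < (t + 1) * (r - t + 1) := by positivity
      omega
    subst hempty
    simpa using hAD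
  | succ p ih =>
    rcases D.eq_empty_or_nonempty with rfl | hne
    · simp only [Finset.filter_empty, Finset.subset_empty] at hAD
      simp [hAD]
    have hkn : k ≤ p + 1 := by
      simpa using Finset.card_le_card (hDn _ (hD.range_mem hk hne le_rfl))
    by_cases hfull : Finset.range (p + 1) ∈ D
    · refine (hA.card_le_choose ht htr (hkr.trans hkn) fun F hF => ?_).trans
        (choose_le_card_filter_range_subset htr ?_ fun F hF => hD.mem_of_subset _ hfull F hF)
      · obtain ⟨hF, hFr⟩ := Finset.mem_filter.1 (hAD hF)
        exact Finset.mem_powersetCard.2 ⟨hDn F hF, hFr⟩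
      · nlinarith [Nat.zero_le (t * (r - t))]
    rcases htr.eq_or_lt with rfl | htr'
    · have h1 : A.card ≤ 1 := by
        rw [Finset.card_le_one]
        intro E hE F hF
        have hEt := (Finset.mem_filter.1 (hAD hE)).2
        have hFt := (Finset.mem_filter.1 (hAD hF)).2
        have h := hA E hE F hF
        rw [← Finset.eq_of_subset_of_card_le (Finset.inter_subset_left (s₁ := E) (s₂ := F))
          (by omega)]
        exact Finset.eq_of_subset_of_card_le Finset.inter_subset_right (by omega)
      refine h1.trans (Finset.card_pos.2 ⟨Finset.range t, Finset.mem_filter.2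
        ⟨hD.range_mem hk hne ?_, subset_rfl, Finset.card_range t⟩⟩)
      nlinarith [Nat.zero_le (t * (t - t))]
    obtain ⟨B, hBD, hB, hc, hBA⟩ := hD.exists_compressedAt p hAD hA
    rw [← hBA, ← Finset.card_filter_add_card_filter_not (p ∈ ·), add_comm]
    refine le_trans (add_le_add ?_ ?_)
      (card_deletion_add_card_vertexLink_le (p := p) (t := t) (ht.trans htr))
    · refine ih htr hkr (hD.deletion hDn) (fun F hF x hx => ?_)
        (hD.extendsTo_deletion hDn hk hfull) (fun F hF => ?_)
        fun E hE F hF => hB E (Finset.mem_filter.1 hE).1 F (Finset.mem_filter.1 hF).1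
      · obtain ⟨hF, hpF⟩ := Finset.mem_filter.1 hF
        have h1 := Finset.mem_range.1 (hDn F hF hx)
        have h2 : x ≠ p := by rintro rfl; exact hpF hx
        exact Finset.mem_range.2 (by omega)
      · obtain ⟨hF, hpF⟩ := Finset.mem_filter.1 hF
        obtain ⟨hFD, hFr⟩ := Finset.mem_filter.1 (hBD hF)
        exact Finset.mem_filter.2 ⟨Finset.mem_filter.2 ⟨hFD, hpF⟩, hFr⟩
    · have hinj : Set.InjOn (fun E : Finset ℕ => E.erase p) (B.filter (p ∈ ·)) :=
        (Finset.erase_injOn' p).mono fun E hE => (Finset.mem_filter.1 hE).2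
      rw [← Finset.card_image_of_injOn hinj]
      have hkr' : (t + 1) * (r - 1 - t + 1) ≤ k - 1 := by
        obtain ⟨d, rfl⟩ : ∃ d, r = t + d + 1 := ⟨r - t - 1, by omega⟩
        rw [show t + d + 1 - t + 1 = d + 1 + 1 by omega] at hkr
        rw [show t + d + 1 - 1 - t + 1 = d + 1 by omega]
        have : (t + 1) * (d + 1) + 1 ≤ k := by nlinarith
        omega
      refine ih (by omega) hkr' (hD.vertexLink hDn) (fun F hF x hx => ?_)
        (hD.extendsTo_vertexLink hk) (fun F hF => ?_) ?_
      · obtain ⟨hF, hpF, -⟩ := Finset.mem_filter.1 hF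
        have h1 := Finset.mem_range.1 (hDn F hF hx)
        have h2 : x ≠ p := by rintro rfl; exact hpF hx
        exact Finset.mem_range.2 (by omega)
      · obtain ⟨E, hE, rfl⟩ := Finset.mem_image.1 hF
        obtain ⟨hE, hpE⟩ := Finset.mem_filter.1 hE
        obtain ⟨hED, hEr⟩ := Finset.mem_filter.1 (hBD hE)
        refine Finset.mem_filter.2 ⟨Finset.mem_filter.2
          ⟨hD.mem_of_subset E hED _ (Finset.erase_subset _ _), Finset.notMem_erase _ _, ?_⟩, ?_⟩
        · rwa [Finset.insert_erase hpE]
        · rw [Finset.card_erase_of_mem hpE, hEr]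
      · intro E' hE' F' hF'
        obtain ⟨E, hE, rfl⟩ := Finset.mem_image.1 hE'
        obtain ⟨F, hF, rfl⟩ := Finset.mem_image.1 hF'
        obtain ⟨hE, hpE⟩ := Finset.mem_filter.1 hE
        obtain ⟨hF, hpF⟩ := Finset.mem_filter.1 hF
        obtain ⟨hED, hEr⟩ := Finset.mem_filter.1 (hBD hE)
        obtain ⟨hFD, hFr⟩ := Finset.mem_filter.1 (hBD hF)
        have h2 : E.erase p ∩ F.erase p = (E ∩ F).erase p := by
          ext x; simp only [Finset.mem_inter, Finset.mem_erase]; tauto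
        simp only [h2]
        by_contra! hcon
        have h3 := hB.card_add_card (fun F hF => Finset.mem_powerset.2
          (hDn F (Finset.mem_filter.1 (hBD hF)).1)) hc hE hF hpE hpF hcon
        -- two `r`-sets covering all `p + 1` vertices would give `p + 1 = 2 * r - t`
        obtain ⟨d, rfl⟩ : ∃ d, r = t + d + 1 := ⟨r - t - 1, by omega⟩
        rw [show t + d + 1 - t + 1 = d + 2 by omega] at hkr
        nlinarith [Nat.mul_le_mul_right d ht]

/-! ### Transfer from `Fin n` -/

/-- The faces of a complex on `Fin n`, viewed as sets of natural numbers. -/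
def FinComplex.natFaces {n : ℕ} (Δ : FinComplex n) : Finset (Finset ℕ) :=
  Δ.faces.image (Finset.map Fin.valEmbedding)

lemma FinComplex.mem_natFaces {n : ℕ} (Δ : FinComplex n) (σ : Finset (Fin n)) :
    σ.map Fin.valEmbedding ∈ Δ.natFaces ↔ σ ∈ Δ.faces := by
  simp [natFaces]

lemma FinComplex.isShiftedComplex_natFaces {n : ℕ} {Δ : FinComplex n} (hΔ : Δ.IsShifted) :
    IsShiftedComplex Δ.natFaces where
  mem_of_subset F hF G hG := by
    obtain ⟨σ, hσ, rfl⟩ := Finset.mem_image.1 hF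
    obtain ⟨τ, hτ, rfl⟩ := Finset.subset_map_iff.1 hG
    exact (Δ.mem_natFaces τ).2 (Δ.isLowerSet_faces hτ hσ)
  shift_mem F hF i hi j hj := by
    obtain ⟨σ, hσ, rfl⟩ := Finset.mem_image.1 hF
    obtain ⟨i, hiσ, rfl⟩ := Finset.mem_map.1 hi
    have hjn : j < n := hj.trans i.2
    have h := (Δ.mem_natFaces _).2 (hΔ σ hσ i hiσ ⟨j, hjn⟩ hj)
    rwa [Finset.map_insert, Finset.map_erase] at h

lemma FinComplex.extendsTo_natFaces {n k : ℕ} {Δ : FinComplex n} (hk : Δ.IsMinFacetCard k) :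
    ExtendsTo k Δ.natFaces := by
  intro F hF hFk
  obtain ⟨σ, hσ, rfl⟩ := Finset.mem_image.1 hF
  rw [Finset.card_map] at hFk
  have hnot : ¬ Δ.IsFacet σ := fun h => absurd (hk.2 ⟨σ, h, rfl⟩) (not_le.2 hFk)
  obtain ⟨τ, hτ, hστ⟩ : ∃ τ ∈ Δ.faces, σ ⊂ τ := by
    by_contra! hcon
    refine hnot ⟨hσ, fun τ hτ hστ => ?_⟩
    by_contra hτσ
    exact hcon τ hτ ⟨hστ, hτσ⟩
  obtain ⟨x, hxτ, hxσ⟩ := Finset.exists_of_ssubset hστ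
  refine ⟨x, fun h => ?_, ?_⟩
  · obtain ⟨y, hy, hyx⟩ := Finset.mem_map.1 h
    rw [Fin.valEmbedding.injective hyx] at hy
    exact hxσ hy
  · have h := (Δ.mem_natFaces (insert x σ)).2
      (Δ.isLowerSet_faces (Finset.insert_subset hxτ hστ.subset) hτ)
    rwa [Finset.map_insert] at h

lemma map_firstVertices {n t : ℕ} (htn : t ≤ n) :
    (firstVertices n t).map Fin.valEmbedding = Finset.range t := by
  ext x
  simp only [firstVertices, Finset.mem_map, Finset.mem_filter, Finset.mem_univ, true_and,
    Fin.valEmbedding_apply, Finset.mem_range]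
  exact ⟨by rintro ⟨i, hi, rfl⟩; exact hi, fun h => ⟨⟨x, h.trans_le htn⟩, h, rfl⟩⟩

lemma FinComplex.card_natFaces_le_link {n t r : ℕ} (Δ : FinComplex n) (htn : t ≤ n) :
    (Δ.natFaces.filter fun F => Finset.range t ⊆ F ∧ F.card = r).card
      ≤ (Δ.link (firstVertices n t)).f (r - t) := by
  have hcard : (firstVertices n t).card = t := by
    rw [← Finset.card_map Fin.valEmbedding, map_firstVertices htn, Finset.card_range]
  have h1 : (Δ.natFaces.filter fun F => Finset.range t ⊆ F ∧ F.card = r)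
      ⊆ (Δ.faces.filter fun σ => firstVertices n t ⊆ σ ∧ σ.card = r).image
        (Finset.map Fin.valEmbedding) := by
    intro F hF
    obtain ⟨hF, htF, hFr⟩ := Finset.mem_filter.1 hF
    obtain ⟨σ, hσ, rfl⟩ := Finset.mem_image.1 hF
    rw [← map_firstVertices htn, Finset.map_subset_map] at htF
    rw [Finset.card_map] at hFr
    exact Finset.mem_image_of_mem _ (Finset.mem_filter.2 ⟨hσ, htF, hFr⟩)
  refine (Finset.card_le_card h1).trans (Finset.card_image_le.trans ?_)
  refine Finset.card_le_card_of_injOn (· \ firstVertices n t) (fun σ hσ => ?_)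
    fun σ hσ τ hτ h => ?_
  · obtain ⟨hσ, htσ, hσr⟩ := Finset.mem_filter.1 hσ
    refine Finset.mem_filter.2 ⟨Finset.mem_filter.2 ⟨Finset.mem_univ _, ?_, ?_⟩, ?_⟩
    · rwa [Finset.sdiff_union_of_subset htσ]
    · exact Finset.sdiff_inter_self _ _
    · rw [Finset.card_sdiff_of_subset htσ, hσr, hcard]
  · rw [← Finset.sdiff_union_of_subset (Finset.mem_filter.1 hσ).2.1,
      ← Finset.sdiff_union_of_subset (Finset.mem_filter.1 hτ).2.1]
    exact congrArg (· ∪ firstVertices n t) h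

theorem lemma3p1 (n : ℕ) (Δ : FinComplex n) (hΔ : Δ.IsShifted)
    (k : ℕ) (hk : Δ.IsMinFacetCard k)
    (t r : ℕ) (ht : 1 ≤ t) (htr : t ≤ r) (hkr : (t + 1) * (r - t + 1) ≤ k) :
    Δ.IsEKR t r ∧
      firstVertices n t ∈ Δ.rFaces t ∧
      ∀ 𝒜 : Finset (Finset (Fin n)), Δ.IsIntersectingFamily t r 𝒜 →
        𝒜.card ≤ (Δ.link (firstVertices n t)).f (r - t) := by
  have hD := FinComplex.isShiftedComplex_natFaces hΔ
  have hDk := FinComplex.extendsTo_natFaces hk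
  have hne : Δ.natFaces.Nonempty := by
    obtain ⟨F, hF, -⟩ := hk.1
    exact ⟨_, (Δ.mem_natFaces F).2 hF.1⟩
  have hDn : ∀ F ∈ Δ.natFaces, F ⊆ Finset.range n := by
    intro F hF x hx
    obtain ⟨σ, -, rfl⟩ := Finset.mem_image.1 hF
    obtain ⟨y, -, rfl⟩ := Finset.mem_map.1 hx
    exact Finset.mem_range.2 y.2
  have htk : t ≤ k := by nlinarith [Nat.zero_le (t * (r - t))]
  have htD : Finset.range t ∈ Δ.natFaces := hD.range_mem hDk hne htk
  have htn : t ≤ n := by simpa using Finset.card_le_card (hDn _ htD)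
  have hfirst : firstVertices n t ∈ Δ.rFaces t := by
    rw [← map_firstVertices htn, Δ.mem_natFaces] at htD
    refine Finset.mem_filter.2 ⟨htD, ?_⟩
    rw [← Finset.card_map Fin.valEmbedding, map_firstVertices htn, Finset.card_range]
  have hmain : ∀ 𝒜 : Finset (Finset (Fin n)), Δ.IsIntersectingFamily t r 𝒜 →
      𝒜.card ≤ (Δ.link (firstVertices n t)).f (r - t) := by
    rintro 𝒜 ⟨h𝒜, hint⟩
    rw [← Finset.card_image_of_injective 𝒜 (Finset.map_injective Fin.valEmbedding)]
    refine (hD.card_le ht htr hkr hDn hDk (fun F hF => ?_) fun A hA B hB => ?_).trans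
      (Δ.card_natFaces_le_link htn)
    · obtain ⟨σ, hσ, rfl⟩ := Finset.mem_image.1 hF
      obtain ⟨hσΔ, hσr⟩ := Finset.mem_filter.1 (h𝒜 hσ)
      exact Finset.mem_filter.2 ⟨(Δ.mem_natFaces σ).2 hσΔ, by rw [Finset.card_map, hσr]⟩
    · obtain ⟨σ, hσ, rfl⟩ := Finset.mem_image.1 hA
      obtain ⟨τ, hτ, rfl⟩ := Finset.mem_image.1 hB
      rw [← Finset.map_inter, Finset.card_map]
      exact hint σ hσ τ hτ
  exact ⟨fun 𝒜 h𝒜 => (hmain 𝒜 h𝒜).trans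
    (Finset.le_sup (f := fun σ => (Δ.link σ).f (r - t)) hfirst), hfirst, hmain⟩
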